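/- Throughout, digraphs are reflexive (every vertex carries a loop). A *path* of length $k$ is a reflexive digraph $\mathbb{P}$ on $\{0,1,\dots,k\}$ in which, for each $0\le i<k$, at least one of the arcs $(i,i+1)$, $(i+1,i)$ is present, and which has no other arcs except loops; the edge between $i$ and $i+1$ is *symmetric* if both arcs are present. Its word $w(\mathbb{P})=x_1\cdots x_k$ over $\{+,-,*\}$ has $x_{i+1}=*$ if the edge between $i$ and $i+1$ is symmetric, and otherwise $x_{i+1}=+$ if $(i,i+1)$ is an arc and $x_{i+1}=-$ if $(i+1,i)$ is an arc. Put $\overline{+}=-$, $\overline{-}=+$, $\overline{*}=*$; the path $\mathbb{P}$ is *self-dual* if $x_1\cdots x_k=\overline{x_k}\cdots\overline{x_1}$. For a word $W=y_1\cdots y_n$ with $n\ge 3$, the *cycle* $C(W)$ is the reflexive digraph on $\{0,\dots,n-1\}$ whose non-loop arcs are, for $1\le i\le n$ and with indices modulo $n$: $(i-1,i)$ if $y_i=+$, $(i,i-1)$ if $y_i=-$, and both if $y_i=*$. A *$p$-ary polymorphism* ($p\ge1$) of a digraph $\mathbb{G}$ with vertex set $G$ is a map $f:G^p\to G$ such that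 $(f(x_1,\dots,x_p),f(y_1,\dots,y_p))$ is an arc whenever $(x_1,y_1),\dots,(x_p,y_p)$ are arcs; it is *essentially unary* if there are an index $i$ and an arc-preserving map $g:G\to G$ with $f(x_1,\dots,x_p)=g(x_i)$ for all $x_1,\dots,x_p\in G$. The digraph $\mathbb{G}$ is *Słupecki* if all its surjective polymorphisms are essentially unary. **Theorem.** Let $\mathbb{P}$ be a self-dual path of length at least $3$ with at least two symmetric edges. Then the cycle $C(w(\mathbb{P})\,+)$, whose word is $w(\mathbb{P})$ followed by the letter $+$, is Słupecki. -/

import Mathlib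

namespace Slupecki

/-- The alphabet `{+, -, *}`; `star` stands for a symmetric edge. -/
inductive Letter where
  | plus
  | minus
  | star
  deriving DecidableEq

/-- Words on the alphabet `{+, -, *}`. -/
abbrev Word := List Letter

/-- The involution on letters: it exchanges `+` and `-` and fixes `*`. -/
def Letter.dual : Letter → Letter
  | .plus => .minus
  | .minus => .plus
  | .star => .star

/-- The involution on words: `x₁ ⋯ x_k` is sent to `dual x_k ⋯ dual x₁`. -/
def Word.dual (W : Word) : Word := (W.map Letter.dual).reverse

/-- A map between the vertex sets of two digraphs is a homomorphism if it preserves arcs. -/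
def IsHom {V V' : Type*} (G : Digraph V) (H : Digraph V') (f : V → V') : Prop :=
  ∀ x y, G.Adj x y → H.Adj (f x) (f y)

/-- The `k`-th power of a digraph: arcs are taken coordinatewise. -/
def power {V : Type*} (G : Digraph V) (k : ℕ) : Digraph (Fin k → V) where
  Adj x y := ∀ i, G.Adj (x i) (y i)

/-- A `k`-ary polymorphism of `G` is a homomorphism from the `k`-th power of `G` to `G`. -/
def IsPolymorphism {V : Type*} (G : Digraph V) (k : ℕ) (f : (Fin k → V) → V) : Prop :=
  IsHom (power G k) G f

/-- `f` depends on one coordinate only, through an endomorphism of `G`. -/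
def IsEssentiallyUnary {V : Type*} (G : Digraph V) (k : ℕ) (f : (Fin k → V) → V) : Prop :=
  ∃ (i : Fin k) (g : V → V), IsHom G G g ∧ ∀ x, f x = g (x i)

/-- A digraph is Słupecki if all its surjective polymorphisms (of any positive arity) are
essentially unary. -/
def IsSlupecki {V : Type*} (G : Digraph V) : Prop :=
  ∀ (k : ℕ) (f : (Fin k → V) → V), 1 ≤ k → IsPolymorphism G k f → Function.Surjective f →
    IsEssentiallyUnary G k f

/-- A (reflexive) path of length `k` on the vertex set `{0, …, k}`: all loops are present, for each
`i < k` at least one of the arcs `(i, i+1)`, `(i+1, i)` is present, and there are no other arcs. -/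
structure IsPath {k : ℕ} (P : Digraph (Fin (k + 1))) : Prop where
  refl : ∀ u, P.Adj u u
  consecutive : ∀ i : Fin k, P.Adj i.castSucc i.succ ∨ P.Adj i.succ i.castSucc
  no_other : ∀ u v, P.Adj u v → u = v ∨ (v : ℕ) = u + 1 ∨ (u : ℕ) = v + 1

open Classical in
/-- The word `w(P)` of a path `P` of length `k`: the letter at position `i` is `*` if both arcs
between `i` and `i + 1` are present; otherwise it is `+` if `(i, i+1)` is an arc and `-` if
`(i+1, i)` is. -/
noncomputable def pathWord {k : ℕ} (P : Digraph (Fin (k + 1))) : Word :=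
  List.ofFn fun i : Fin k =>
    if P.Adj i.castSucc i.succ ∧ P.Adj i.succ i.castSucc then Letter.star
    else if P.Adj i.castSucc i.succ then Letter.plus
    else Letter.minus

/-- A path is self-dual if its word is fixed by the involution. -/
def IsSelfDual {k : ℕ} (P : Digraph (Fin (k + 1))) : Prop :=
  pathWord P = Word.dual (pathWord P)

/-- The number of symmetric edges of a path. -/
noncomputable def numSymmetricEdges {k : ℕ} (P : Digraph (Fin (k + 1))) : ℕ :=
  (pathWord P).count Letter.star

/-- The (reflexive) cycle `C(W)` associated to a word `W` of length `n`, on the vertex set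
`{0, …, n-1}`: the letter of `W` in (zero-based) position `u` describes the arcs between `u` and
`u + 1` modulo `n`, namely `(u, u+1)` if it is `+`, `(u+1, u)` if it is `-`, and both if it is
`*`; moreover all loops are present. -/
def cycle (W : Word) : Digraph (Fin W.length) where
  Adj u v := u = v ∨
    ((v : ℕ) = (u + 1) % W.length ∧ (W.get u = Letter.plus ∨ W.get u = Letter.star)) ∨
    ((u : ℕ) = (v + 1) % W.length ∧ (W.get v = Letter.minus ∨ W.get v = Letter.star))

end Slupecki

/-! Let `n` be the length of the cycle. A polymorphism `f` lifts to a homomorphism `F` from a power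
of the universal cover, a path on `ℤ`, to the cover (`exists_lift`), and `F` has a degree in each
coordinate (`exists_degree`). If some degree is nonzero, `F` has slope `1` or `-1` in that
coordinate, and a symmetric edge forces `f` to depend on that coordinate only
(`isEssentiallyUnary_of_degree_ne_zero`). If all degrees vanish, `f` lifts to a map `H` from the
power of the cycle to `ℤ`. Let `x` minimise `H`. A surjective `f` takes the value below `H x - 1` at
some `y`, and minimality gives `H y ≥ H x + n - 1`. But a pattern of arc directions joining any two
vertices of the cycle also joins `x` to `y`, so its image under `H` must climb `n - 1`. It remains
to find a pattern too short for this (`isSlupecki_of_walks`). For `n ≥ 6` the alternating pattern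
works: if a greedy walk goes round in time `D`, going the shorter way joins any two vertices in time
about `D / 2`, while climbing `n - 1` takes nearly `D`. The remaining cycles are checked by
computation. -/

namespace Slupecki

/-! ### Universal cover and lifting of homomorphisms -/

/-- The vertex of the cycle of `W` below an integer. -/
def residue (W : Word) [NeZero W.length] (a : ℤ) : Fin W.length :=
  ⟨(a % W.length).toNat, by
    have := Int.emod_lt_of_pos a (Int.natCast_pos.2 (NeZero.pos W.length))
    have := Int.emod_nonneg a (Int.natCast_ne_zero.2 (NeZero.ne W.length))
    omega⟩

/-- The universal cover of the cycle of `W`: a two-way infinite path on `ℤ`. -/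
def cover (W : Word) [NeZero W.length] : Digraph ℤ where
  Adj a b := a = b ∨
    (b = a + 1 ∧ (W.get (residue W a) = .plus ∨ W.get (residue W a) = .star)) ∨
    (a = b + 1 ∧ (W.get (residue W b) = .minus ∨ W.get (residue W b) = .star))

section Cover

variable {W : Word} [NeZero W.length]

theorem coe_residue (a : ℤ) : ((residue W a : ℕ) : ℤ) = a % W.length := by
  have := Int.emod_nonneg a (Int.natCast_ne_zero.2 (NeZero.ne W.length))
  simp only [residue]
  omega

theorem residue_eq_iff {a b : ℤ} : residue W a = residue W b ↔ (W.length : ℤ) ∣ b - a := by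
  rw [← Int.modEq_iff_dvd, Int.ModEq, ← coe_residue, ← coe_residue, Fin.ext_iff]
  norm_cast

theorem residue_coe (v : Fin W.length) : residue W ((v : ℕ) : ℤ) = v := by
  rw [Fin.ext_iff, ← Int.natCast_inj, coe_residue]
  exact Int.emod_eq_of_lt (by omega) (by have := v.2; omega)

theorem residue_add_length (a : ℤ) : residue W (a + W.length) = residue W a :=
  residue_eq_iff.2 ⟨-1, by ring⟩

theorem eq_of_residue_eq {a b : ℤ} (h : residue W a = residue W b) (hab : |b - a| < W.length) :
    a = b := by
  have := Int.eq_zero_of_abs_lt_dvd (residue_eq_iff.1 h) hab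
  omega

theorem coe_residue_add_one (a : ℤ) :
    (residue W (a + 1) : ℕ) = ((residue W a : ℕ) + 1) % W.length := by
  rw [← Int.natCast_inj, coe_residue]
  push_cast
  rw [coe_residue, Int.emod_add_emod]

theorem cover_refl (a : ℤ) : (cover W).Adj a a := Or.inl rfl

theorem abs_sub_le_of_cover {a b : ℤ} (h : (cover W).Adj a b) : |b - a| ≤ 1 := by
  rcases h with h | h | h <;> rw [abs_le] <;> omega

theorem isHom_residue : IsHom (cover W) (cycle W) (residue W) := by
  rintro a b (rfl | ⟨rfl, h⟩ | ⟨rfl, h⟩)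
  · exact Or.inl rfl
  · exact Or.inr (Or.inl ⟨coe_residue_add_one a, h⟩)
  · exact Or.inr (Or.inr ⟨coe_residue_add_one b, h⟩)

theorem cover_adj_add_length {a b : ℤ} (h : (cover W).Adj a b) :
    (cover W).Adj (a + W.length) (b + W.length) := by
  simp only [cover, residue_add_length] at h ⊢
  rcases h with h | h | h
  · exact Or.inl (by omega)
  · exact Or.inr (Or.inl ⟨by omega, h.2⟩)
  · exact Or.inr (Or.inr ⟨by omega, h.2⟩)

theorem exists_cover_adj {a : ℤ} {v : Fin W.length} (h : (cycle W).Adj (residue W a) v) :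
    ∃ b, (cover W).Adj a b ∧ residue W b = v := by
  rcases h with rfl | ⟨h, hl⟩ | ⟨h, hl⟩
  · exact ⟨a, cover_refl a, rfl⟩
  · exact ⟨a + 1, Or.inr (Or.inl ⟨rfl, hl⟩), Fin.ext (by rw [coe_residue_add_one, h])⟩
  · have hv : residue W (a - 1) = v := by
      rw [← residue_coe v, residue_eq_iff]
      have h' : residue W a = residue W ((v : ℕ) + 1 : ℤ) := by
        refine Fin.ext ?_
        rw [coe_residue_add_one, residue_coe, h]
      have := residue_eq_iff.1 h'
      rwa [show ((v : ℕ) : ℤ) - (a - 1) = (v : ℕ) + 1 - a by ring]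
    exact ⟨a - 1, Or.inr (Or.inr ⟨by ring, by rwa [hv]⟩), hv⟩

theorem exists_cover_adj' {a : ℤ} {v : Fin W.length} (h : (cycle W).Adj v (residue W a)) :
    ∃ b, (cover W).Adj b a ∧ residue W b = v := by
  rcases h with rfl | ⟨h, hl⟩ | ⟨h, hl⟩
  · exact ⟨a, cover_refl a, rfl⟩
  · have hv : residue W (a - 1) = v := by
      rw [← residue_coe v, residue_eq_iff]
      have h' : residue W a = residue W ((v : ℕ) + 1 : ℤ) := by
        refine Fin.ext ?_
        rw [coe_residue_add_one, residue_coe, h]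
      have := residue_eq_iff.1 h'
      rwa [show ((v : ℕ) : ℤ) - (a - 1) = (v : ℕ) + 1 - a by ring]
    exact ⟨a - 1, Or.inr (Or.inl ⟨by ring, by rwa [hv]⟩), hv⟩
  · exact ⟨a + 1, Or.inr (Or.inr ⟨rfl, hl⟩), Fin.ext (by rw [coe_residue_add_one, h])⟩

/-- An arc of a cycle of length at least four lifts to an arc between any two sufficiently close
integers above its ends. -/
theorem cover_adj_of_residue (hW : 4 ≤ W.length) {a b : ℤ}
    (h : (cycle W).Adj (residue W a) (residue W b)) (hab : |b - a| ≤ 2) :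
    (cover W).Adj a b := by
  obtain ⟨c, hc, hcb⟩ := exists_cover_adj h
  have hca := abs_sub_le_of_cover hc
  -- `c` and `b` lie over the same vertex at distance at most `1 + 2 = 3`, hence the length four.
  obtain rfl : c = b := by
    refine eq_of_residue_eq hcb ?_
    rw [abs_le] at hab hca
    rw [abs_lt]
    omega
  exact hc

theorem cover_adj_succ (a : ℤ) : (cover W).Adj a (a + 1) ∨ (cover W).Adj (a + 1) a := by
  cases h : W.get (residue W a)
  · exact Or.inl (Or.inr (Or.inl ⟨rfl, Or.inl h⟩))
  · exact Or.inr (Or.inr (Or.inr ⟨rfl, Or.inl h⟩))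
  · exact Or.inl (Or.inr (Or.inl ⟨rfl, Or.inr h⟩))

/-- A map from `ℤ` to the cycle along which consecutive values are adjacent lifts to the cover. -/
theorem exists_path_lift (γ : ℤ → Fin W.length)
    (hγ : ∀ t, (cycle W).Adj (γ t) (γ (t + 1)) ∨ (cycle W).Adj (γ (t + 1)) (γ t))
    (s : ℤ) (hs : residue W s = γ 0) :
    ∃ q : ℤ → ℤ, q 0 = s ∧ (∀ t, residue W (q t) = γ t) ∧ ∀ t, |q (t + 1) - q t| ≤ 1 := by
  have near : ∀ a v, ((cycle W).Adj (residue W a) v ∨ (cycle W).Adj v (residue W a)) →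
      ∃ b, residue W b = v ∧ |b - a| ≤ 1 := by
    rintro a v (h | h)
    · obtain ⟨b, hb, hv⟩ := exists_cover_adj h
      exact ⟨b, hv, abs_sub_le_of_cover hb⟩
    · obtain ⟨b, hb, hv⟩ := exists_cover_adj' h
      exact ⟨b, hv, by rw [abs_sub_comm]; exact abs_sub_le_of_cover hb⟩
  have up : ∀ t a, residue W a = γ t → ∃ b, residue W b = γ (t + 1) ∧ |b - a| ≤ 1 :=
    fun t a h => near a _ (by rw [h]; exact hγ t)
  have down : ∀ t a, residue W a = γ t → ∃ b, residue W b = γ (t - 1) ∧ |b - a| ≤ 1 := by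
    intro t a h
    refine near a _ ?_
    have := hγ (t - 1)
    rw [sub_add_cancel] at this
    rw [h]
    exact this.symm
  choose! U hU hU' using up
  choose! D hD hD' using down
  let Q : ∀ t : ℤ, {a : ℤ // residue W a = γ t} := fun t =>
    Int.inductionOn' t 0 ⟨s, hs⟩ (fun k _ x => ⟨U k x.1, hU k x.1 x.2⟩)
      (fun k _ x => ⟨D k x.1, hD k x.1 x.2⟩)
  refine ⟨fun t => (Q t).1, ?_, fun t => (Q t).2, fun t => ?_⟩
  · simp [Q, Int.inductionOn'_self]
  · rcases le_or_gt 0 t with ht | ht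
    · have : Q (t + 1) = ⟨U t (Q t).1, hU t _ (Q t).2⟩ := Int.inductionOn'_add_one ht
      simp only [this]
      exact hU' t _ (Q t).2
    · have h : Q (t + 1 - 1) = ⟨D (t + 1) (Q (t + 1)).1, hD (t + 1) _ (Q (t + 1)).2⟩ :=
        Int.inductionOn'_sub_one (by omega)
      have h2 : (Q t).1 = (Q (t + 1 - 1)).1 := by rw [add_sub_cancel_right]
      simp only [h2, h]
      rw [abs_sub_comm]
      exact hD' (t + 1) _ (Q (t + 1)).2

/-- Homomorphisms from powers of the cover to a cycle of length at least four lift to the cover. -/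
theorem exists_lift (hW : 4 ≤ W.length) :
    ∀ (k : ℕ) (f : (Fin k → ℤ) → Fin W.length), IsHom (power (cover W) k) (cycle W) f →
      ∃ F : (Fin k → ℤ) → ℤ, IsHom (power (cover W) k) (cover W) F ∧ ∀ x, residue W (F x) = f x
  | 0, f, _ => ⟨fun _ => (f 0 : ℕ), fun _ _ _ => cover_refl _, fun x => by
      rw [residue_coe, Subsingleton.elim x 0]⟩
  | k + 1, f, hf => by
    have hcons : ∀ {s t : ℤ} {x y : Fin k → ℤ}, (cover W).Adj s t → (power (cover W) k).Adj x y →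
        (cycle W).Adj (f (Fin.cons s x)) (f (Fin.cons t y)) := fun hst hxy =>
      hf _ _ (fun i => Fin.cases (by simpa using hst) (fun j => by simpa using hxy j) i)
    have hrefl : ∀ x : Fin k → ℤ, (power (cover W) k).Adj x x := fun x i => cover_refl _
    obtain ⟨F₀, hF₀, hf₀⟩ := exists_lift hW k (fun x => f (Fin.cons 0 x))
      (fun x y hxy => hcons (cover_refl 0) hxy)
    have hex : ∀ x : Fin k → ℤ, ∃ q : ℤ → ℤ, q 0 = F₀ x ∧
        (∀ t, residue W (q t) = f (Fin.cons t x)) ∧ ∀ t, |q (t + 1) - q t| ≤ 1 := fun x =>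
      exists_path_lift _ (fun t => (cover_adj_succ t).imp (fun h => hcons h (hrefl x))
        (fun h => hcons h (hrefl x))) _ (hf₀ x)
    choose q hq₀ hqf hq using hex
    have hadj : ∀ {s t : ℤ} {x y : Fin k → ℤ}, (cover W).Adj s t → (power (cover W) k).Adj x y →
        |q y t - q x s| ≤ 2 → (cover W).Adj (q x s) (q y t) := fun hst hxy h =>
      cover_adj_of_residue hW (by rw [hqf, hqf]; exact hcons hst hxy) h
    -- The lifts over adjacent lines stay close: the diagonal arc between times `t` and `t + 1`
    -- joins lifts at distance at most 2, hence at most 1, and this in turn bounds the distance at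
    -- the other time by 2, hence by 1.
    have hstep : ∀ {x y : Fin k → ℤ}, (power (cover W) k).Adj x y → ∀ t,
        (|q y t - q x t| ≤ 1 ↔ |q y (t + 1) - q x (t + 1)| ≤ 1) := by
      intro x y hxy t
      have hx := hq x t
      have hy := hq y t
      have key : ∀ {s s' : ℤ}, (cover W).Adj s s' → |q y s' - q x s| ≤ 2 →
          |q y s' - q x s| ≤ 1 := fun h h' => abs_sub_le_of_cover (hadj h hxy h')
      have k₀ := @key t t (cover_refl t)
      have k₁ := @key (t + 1) (t + 1) (cover_refl _)
      rcases cover_adj_succ (W := W) t with h | h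
      · have k₂ := key h
        simp only [abs_le] at *
        constructor <;> intro h0 <;> omega
      · have k₂ := key h
        simp only [abs_le] at *
        constructor <;> intro h0 <;> omega
    have hclose : ∀ {x y : Fin k → ℤ}, (power (cover W) k).Adj x y → ∀ t, |q y t - q x t| ≤ 1 := by
      intro x y hxy t
      induction t using Int.induction_on with
      | zero =>
        rw [hq₀, hq₀]
        exact abs_sub_le_of_cover (hF₀ x y hxy)
      | succ i ih => exact (hstep hxy _).1 ih
      | pred i ih => exact (hstep hxy _).2 (by rwa [sub_add_cancel])
    refine ⟨fun x => q (Fin.tail x) (x 0), fun x y hxy => ?_, fun x => ?_⟩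
    · have ht : (power (cover W) k).Adj (Fin.tail x) (Fin.tail y) := fun i => hxy i.succ
      refine hadj (hxy 0) ht ?_
      have h1 := hclose ht (x 0)
      have h2 : |q (Fin.tail y) (y 0) - q (Fin.tail y) (x 0)| ≤ 1 := by
        rcases hxy 0 with h | ⟨h, -⟩ | ⟨h, -⟩
        · simp [h]
        · rw [h]; exact hq _ _
        · rw [h, abs_sub_comm]; exact hq _ _
      rw [abs_le] at *
      omega
    · rw [hqf, Fin.cons_self_tail]

end Cover

/-! ### Degrees of a lift -/

/-- A function on a power that is unchanged by the admissible changes of a single coordinate is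
unchanged by the admissible changes of all coordinates. -/
theorem eq_of_forall_update {k : ℕ} {X α : Type*} {r : X → X → Prop} {φ : (Fin k → X) → α}
    (h : ∀ x i t, r (x i) t → φ (Function.update x i t) = φ x) {x y : Fin k → X}
    (hxy : ∀ i, r (x i) (y i)) : φ y = φ x := by
  classical
  have key : ∀ s : Finset (Fin k), φ (fun i => if i ∈ s then y i else x i) = φ x := by
    intro s
    induction s using Finset.induction_on with
    | empty => simp
    | insert a s ha ih =>
      rw [← ih]
      convert h (fun i => if i ∈ s then y i else x i) a (y a) (by simpa [ha] using hxy a) using 2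
      ext i
      by_cases hi : i = a
      · subst hi; simp
      · simp [hi]
  simpa using key Finset.univ

section Degree

variable {W : Word} [NeZero W.length]

theorem power_cover_adj_update {k : ℕ} {x y : Fin k → ℤ} (h : (power (cover W) k).Adj x y)
    (i : Fin k) {s t : ℤ} (hst : (cover W).Adj s t) :
    (power (cover W) k).Adj (Function.update x i s) (Function.update y i t) := by
  intro j
  by_cases hj : j = i
  · subst hj; simpa using hst
  · simpa [hj] using h j

theorem power_cover_refl {k : ℕ} (x : Fin k → ℤ) : (power (cover W) k).Adj x x :=
  fun _ => cover_refl _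

/-- A function that is constant along the arcs of a power of the cover is constant. -/
theorem eq_of_forall_adj {k : ℕ} {α : Type*} {φ : (Fin k → ℤ) → α}
    (h : ∀ x y, (power (cover W) k).Adj x y → φ x = φ y) (x y : Fin k → ℤ) : φ x = φ y := by
  refine (eq_of_forall_update (r := fun _ _ => True) (fun x i t _ => ?_) (fun _ => trivial)).symm
  have hsucc : ∀ t, φ (Function.update x i (t + 1)) = φ (Function.update x i t) := fun t =>
    (cover_adj_succ (W := W) t).elim
      (fun h' => (h _ _ (power_cover_adj_update (power_cover_refl x) i h')).symm)
      (fun h' => h _ _ (power_cover_adj_update (power_cover_refl x) i h'))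
  have hzero : ∀ t, φ (Function.update x i t) = φ (Function.update x i 0) := by
    intro t
    induction t using Int.induction_on with
    | zero => rfl
    | succ j ih => rw [hsucc, ih]
    | pred j ih => rw [← ih, ← hsucc, sub_add_cancel]
  rw [hzero t, ← hzero (x i), Function.update_eq_self]

theorem abs_sub_le_of_lipschitz {q : ℤ → ℤ} (hq : ∀ t, |q (t + 1) - q t| ≤ 1) (a : ℤ) (m : ℕ) :
    |q (a + m) - q a| ≤ m := by
  induction m with
  | zero => simp
  | succ m ih =>
    have := hq (a + m)
    push_cast
    rw [← add_assoc]
    rw [abs_le] at *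
    omega

/-- A `1`-Lipschitz map of degree `d ≠ 0` has slope `d`, and `d = ± 1`. -/
theorem slope_of_degree_ne_zero {n : ℕ} (hn : 0 < n) {q : ℤ → ℤ} (hq : ∀ t, |q (t + 1) - q t| ≤ 1)
    {d : ℤ} (hd : d ≠ 0) (hdeg : ∀ t, q (t + n) = q t + n * d) :
    (d = 1 ∨ d = -1) ∧ ∀ t, q t = q 0 + d * t := by
  obtain ⟨m, rfl⟩ : ∃ m, n = m + 1 := ⟨n - 1, by omega⟩
  have hone : d = 1 ∨ d = -1 := by
    have h0 := abs_sub_le_of_lipschitz hq 0 (m + 1)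
    rw [hdeg, add_sub_cancel_left, abs_mul, Nat.abs_cast] at h0
    have h1 : |d| ≤ 1 := by
      by_contra! h
      push_cast at h0
      nlinarith
    rw [abs_le] at h1
    omega
  -- The other `m = n - 1` steps of a period contribute at most `n - 1` of the displacement `n * d`,
  -- so no step can fall short.
  have hstep : ∀ t, q (t + 1) = q t + d := by
    intro t
    have h1 := abs_sub_le_of_lipschitz hq (t + 1) m
    have h2 := hq t
    have h3 := hdeg t
    rw [show t + ((m + 1 : ℕ) : ℤ) = t + 1 + m by push_cast; ring] at h3
    push_cast at h3
    rw [h3] at h1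
    rw [abs_le] at h1 h2
    rcases hone with rfl | rfl <;> omega
  refine ⟨hone, fun t => ?_⟩
  induction t using Int.induction_on with
  | zero => simp
  | succ j ih => rw [hstep, ih]; ring
  | pred j ih =>
    have := hstep (-j - 1)
    rw [sub_add_cancel, ih] at this
    linarith

theorem lipschitz_update {k : ℕ} {F : (Fin k → ℤ) → ℤ} (hF : IsHom (power (cover W) k) (cover W) F)
    (x : Fin k → ℤ) (i : Fin k) (t : ℤ) :
    |F (Function.update x i (t + 1)) - F (Function.update x i t)| ≤ 1 := by
  rcases cover_adj_succ (W := W) t with h | h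
  · exact abs_sub_le_of_cover (hF _ _ (power_cover_adj_update (power_cover_refl x) i h))
  · rw [abs_sub_comm]
    exact abs_sub_le_of_cover (hF _ _ (power_cover_adj_update (power_cover_refl x) i h))

/-- The degree of a lift of a map from a power of the cycle in a given coordinate. -/
theorem exists_degree (hW : 4 ≤ W.length) {k : ℕ} {f : (Fin k → Fin W.length) → Fin W.length}
    {F : (Fin k → ℤ) → ℤ} (hF : IsHom (power (cover W) k) (cover W) F)
    (hf : ∀ x, residue W (F x) = f (fun j => residue W (x j))) (i : Fin k) :
    ∃ d : ℤ, ∀ x t, F (Function.update x i (t + W.length)) =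
      F (Function.update x i t) + W.length * d := by
  have hdvd : ∀ x, (W.length : ℤ) ∣ F (Function.update x i (x i + W.length)) - F x := by
    intro x
    rw [← residue_eq_iff, hf, hf]
    congr 1
    ext j : 1
    by_cases hj : j = i
    · subst hj; simp [residue_add_length]
    · simp [hj]
  -- These differences are multiples of the length and change by at most 2 along an arc.
  have hconst : ∀ x y, F (Function.update x i (x i + W.length)) - F x =
      F (Function.update y i (y i + W.length)) - F y := by
    refine eq_of_forall_adj (W := W) fun x y hxy => ?_
    have h1 := abs_sub_le_of_cover (hF _ _ hxy)
    have h2 := abs_sub_le_of_cover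
      (hF _ _ (power_cover_adj_update hxy i (cover_adj_add_length (hxy i))))
    refine eq_of_sub_eq_zero (Int.eq_zero_of_abs_lt_dvd (dvd_sub (hdvd x) (hdvd y)) ?_)
    rw [abs_le] at h1 h2
    rw [abs_lt]
    omega
  obtain ⟨d, hd⟩ := hdvd 0
  refine ⟨d, fun x t => ?_⟩
  have := hconst (Function.update x i t) 0
  rw [hd] at this
  simp only [Function.update_self, Function.update_idem] at this
  linarith

/-- A polymorphism whose lift has nonzero degree in some coordinate is essentially unary. -/
theorem isEssentiallyUnary_of_degree_ne_zero {k : ℕ}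
    {f : (Fin k → Fin W.length) → Fin W.length} (hpol : IsPolymorphism (cycle W) k f)
    {F : (Fin k → ℤ) → ℤ} (hF : IsHom (power (cover W) k) (cover W) F)
    (hf : ∀ x, residue W (F x) = f (fun j => residue W (x j))) {i : Fin k} {d : ℤ} (hd : d ≠ 0)
    (hdeg : ∀ x t, F (Function.update x i (t + W.length)) =
      F (Function.update x i t) + W.length * d)
    {s : ℤ} (hs : W.get (residue W s) = .star) : IsEssentiallyUnary (cycle W) k f := by
  have hslope := fun x => slope_of_degree_ne_zero (NeZero.pos W.length)
    (q := fun t => F (Function.update x i t)) (lipschitz_update hF x i) hd (hdeg x)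
  have hone := (hslope 0).1
  have hup : (cover W).Adj s (s + 1) := Or.inr (Or.inl ⟨rfl, Or.inr hs⟩)
  have hdown : (cover W).Adj (s + 1) s := Or.inr (Or.inr ⟨rfl, Or.inr hs⟩)
  have hline : ∀ x t, F x - d * x i = F (Function.update x i t) - d * t := by
    intro x t
    have h1 := (hslope x).2 t
    have h2 := (hslope x).2 (x i)
    simp only [Function.update_eq_self] at h1 h2
    rw [h1, h2]
    ring
  have hconst : ∀ x y, F x - d * x i = F y - d * y i := by
    refine eq_of_forall_adj (W := W) fun x y hxy => ?_
    -- Moving the `i`-th coordinates to a loop and to both arcs of the symmetric edge shows that the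
    -- change of `F x - d * x i`, shifted by `0`, `d` and `-d`, stays in `[-1, 1]`; so it is zero.
    have h : ∀ {a b : ℤ}, (cover W).Adj a b →
        |(F y - d * y i + d * b) - (F x - d * x i + d * a)| ≤ 1 := by
      intro a b hab
      rw [hline x a, hline y b, sub_add_cancel, sub_add_cancel]
      exact abs_sub_le_of_cover (hF _ _ (power_cover_adj_update hxy i hab))
    have h0 := h (cover_refl s)
    have h1 := h hup
    have h2 := h hdown
    rw [abs_le] at h0 h1 h2
    rcases hone with rfl | rfl <;> omega
  have hval : ∀ v, f v = residue W (F 0 + d * (v i : ℕ)) := by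
    intro v
    have h1 := hf fun j => ((v j : ℕ) : ℤ)
    simp only [residue_coe] at h1
    rw [← h1]
    have := hconst (fun j => ((v j : ℕ) : ℤ)) 0
    simp only [Pi.zero_apply, mul_zero, sub_zero] at this
    congr 1
    linarith
  refine ⟨i, fun u => f fun _ => u, fun u v huv => hpol _ _ fun _ => huv, fun x => ?_⟩
  simp only [hval]

/-- A lift of degree zero in all coordinates descends to the power of the cycle. -/
theorem exists_hom_of_degree_zero {k : ℕ} {f : (Fin k → Fin W.length) → Fin W.length}
    {F : (Fin k → ℤ) → ℤ} (hF : IsHom (power (cover W) k) (cover W) F)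
    (hf : ∀ x, residue W (F x) = f (fun j => residue W (x j)))
    (hdeg : ∀ i x t, F (Function.update x i (t + W.length)) = F (Function.update x i t)) :
    ∃ H : (Fin k → Fin W.length) → ℤ, IsHom (power (cycle W) k) (cover W) H ∧
      ∀ v, residue W (H v) = f v := by
  have hper : ∀ x i t (m : ℤ),
      F (Function.update x i (t + m * W.length)) = F (Function.update x i t) := by
    intro x i t m
    induction m using Int.induction_on with
    | zero => simp
    | succ j ih => rw [← ih, ← hdeg i x (t + j * W.length)]; congr 2; ring
    | pred j ih => rw [← ih, ← hdeg]; congr 2; ring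
  have hinv : ∀ {x y : Fin k → ℤ}, (∀ i, residue W (x i) = residue W (y i)) → F y = F x := by
    intro x y hxy
    refine eq_of_forall_update (r := fun a b => residue W a = residue W b) (fun x i t h => ?_) hxy
    obtain ⟨m, hm⟩ := residue_eq_iff.1 h
    rw [show t = x i + m * W.length by linarith, hper, Function.update_eq_self]
  refine ⟨fun v => F fun j => ((v j : ℕ) : ℤ), fun u v huv => ?_, fun v => ?_⟩
  · have : ∀ j, ∃ b, (cover W).Adj ((u j : ℕ) : ℤ) b ∧ residue W b = v j := fun j =>
      exists_cover_adj (by rw [residue_coe]; exact huv j)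
    choose y hy hyv using this
    have hFv : F (fun j => ((v j : ℕ) : ℤ)) = F y :=
      hinv fun j => by rw [residue_coe, hyv]
    simp only [hFv]
    exact hF _ _ hy
  · simp only [hf, residue_coe]

end Degree

/-! ### Walks with a prescribed pattern of directions -/

/-- A walk on `G` during the time interval `[φ, ψ]`; the step at time `t` follows an arc forwards
if `d t` holds and backwards otherwise. -/
def IsWalk {V : Type*} (G : Digraph V) (d : ℤ → Prop) (φ ψ : ℤ) (p : ℤ → V) : Prop :=
  ∀ t, φ ≤ t → t < ψ → (d t → G.Adj (p t) (p (t + 1))) ∧ (¬ d t → G.Adj (p (t + 1)) (p t))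

/-- The existence of a walk with given ends. -/
def Reaches {V : Type*} (G : Digraph V) (d : ℤ → Prop) (φ ψ : ℤ) (x y : V) : Prop :=
  ∃ p, IsWalk G d φ ψ p ∧ p φ = x ∧ p ψ = y

theorem IsWalk.map {V V' : Type*} {G : Digraph V} {H : Digraph V'} {f : V → V'}
    (hf : IsHom G H f) {d : ℤ → Prop} {φ ψ : ℤ} {p : ℤ → V} (hp : IsWalk G d φ ψ p) :
    IsWalk H d φ ψ (f ∘ p) := fun t h1 h2 =>
  ⟨fun h => hf _ _ ((hp t h1 h2).1 h), fun h => hf _ _ ((hp t h1 h2).2 h)⟩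

theorem Reaches.map {V V' : Type*} {G : Digraph V} {H : Digraph V'} {f : V → V'}
    (hf : IsHom G H f) {d : ℤ → Prop} {φ ψ : ℤ} {x y : V} (h : Reaches G d φ ψ x y) :
    Reaches H d φ ψ (f x) (f y) := by
  obtain ⟨p, hp, rfl, rfl⟩ := h
  exact ⟨f ∘ p, hp.map hf, rfl, rfl⟩

/-- Walks in the coordinates combine because they share one pattern and one time interval. -/
theorem Reaches.pi {V : Type*} {G : Digraph V} {k : ℕ} {d : ℤ → Prop} {φ ψ : ℤ} {x y : Fin k → V}
    (h : ∀ i, Reaches G d φ ψ (x i) (y i)) : Reaches (power G k) d φ ψ x y := by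
  choose p hp h1 h2 using h
  exact ⟨fun t i => p i t, fun t ht ht' => ⟨fun hd i => (hp i t ht ht').1 hd,
    fun hd i => (hp i t ht ht').2 hd⟩, funext h1, funext h2⟩

theorem Reaches.trans {V : Type*} {G : Digraph V} {d : ℤ → Prop} {φ χ ψ : ℤ} {x y z : V}
    (h : φ ≤ χ) (h' : χ ≤ ψ) (hxy : Reaches G d φ χ x y) (hyz : Reaches G d χ ψ y z) :
    Reaches G d φ ψ x z := by
  obtain ⟨p, hp, rfl, rfl⟩ := hxy
  obtain ⟨q, hq, hpq, rfl⟩ := hyz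
  refine ⟨fun t => if t ≤ χ then p t else q t, fun t h1 h2 => ?_, by simp [h], ?_⟩
  · rcases lt_trichotomy t χ with ht | rfl | ht
    · simp only [ht.le, show t + 1 ≤ χ by omega, if_true]
      exact hp t h1 ht
    · simp only [le_refl, if_true, show ¬ t + 1 ≤ t by omega, if_false, ← hpq]
      exact hq t le_rfl h2
    · simp only [show ¬ t ≤ χ by omega, show ¬ t + 1 ≤ χ by omega, if_false]
      exact hq t ht.le h2
  · rcases h'.lt_or_eq with h' | rfl
    · simp [h'.not_ge]
    · simp [hpq]

theorem Reaches.stay {V : Type*} {G : Digraph V} (hG : ∀ v, G.Adj v v) (d : ℤ → Prop) (φ ψ : ℤ)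
    (x : V) : Reaches G d φ ψ x x :=
  ⟨fun _ => x, fun _ _ _ => ⟨fun _ => hG x, fun _ => hG x⟩, rfl, rfl⟩

theorem Reaches.single {V : Type*} {G : Digraph V} {d : ℤ → Prop} {φ : ℤ} {x y : V}
    (h : d φ → G.Adj x y) (h' : ¬ d φ → G.Adj y x) : Reaches G d φ (φ + 1) x y := by
  refine ⟨fun t => if t ≤ φ then x else y, fun t h1 h2 => ?_, by simp, by simp⟩
  obtain rfl : t = φ := by omega
  simpa using And.intro h h'

/-- A cycle of length at least four with a symmetric edge is Słupecki, provided that for each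
`s` there is a pattern of arcs joining any two vertices of the cycle that is too short to lead from
`s` to `s + (n - 1)` in the universal cover. -/
theorem isSlupecki_of_walks {W : Word} [NeZero W.length] (hW : 4 ≤ W.length)
    (hstar : Letter.star ∈ W)
    (hwalk : ∀ s : ℤ, ∃ (d : ℤ → Prop) (φ ψ : ℤ),
      (∀ u v, Reaches (cycle W) d φ ψ u v) ∧
      ∀ p : ℤ → ℤ, IsWalk (cover W) d φ ψ p → p φ = s → p ψ < s + W.length - 1) :
    IsSlupecki (cycle W) := by
  intro k f _ hpol hsurj
  obtain ⟨F, hF, hf⟩ := exists_lift hW k (fun x => f fun j => residue W (x j))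
    (fun x y hxy => hpol _ _ fun j => isHom_residue _ _ (hxy j))
  choose d hd using exists_degree hW hF hf
  by_cases hzero : ∀ i, d i = 0
  · exfalso
    obtain ⟨H, hH, hHf⟩ := exists_hom_of_degree_zero hF hf fun i x t => by
      rw [hd, hzero i, mul_zero, add_zero]
    obtain ⟨x, hx⟩ := Finite.exists_min H
    obtain ⟨d, φ, ψ, hreach, hp⟩ := hwalk (H x)
    -- `H y` is congruent to `H x - 1` and at least `H x`, so it should be at least `H x + n - 1`,
    -- out of reach of the walk.
    obtain ⟨y, hy⟩ := hsurj (residue W (H x - 1))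
    obtain ⟨p, hpw, h1, h2⟩ := (Reaches.pi fun i => hreach (x i) (y i)).map hH
    have h3 := hp p hpw h1
    have h4 := hx y
    rw [← hHf, residue_eq_iff] at hy
    have h5 := Int.eq_zero_of_abs_lt_dvd hy (by rw [abs_lt]; omega)
    omega
  · push Not at hzero
    obtain ⟨i, hi⟩ := hzero
    obtain ⟨s, hs⟩ := List.mem_iff_get.1 hstar
    exact isEssentiallyUnary_of_degree_ne_zero hpol hF hf hi (hd i) (s := (s : ℕ))
      (by rw [residue_coe, hs])

/-! ### Alternating pattern and greedy schedules -/

section Alternating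

variable {W : Word} [NeZero W.length]

/-- An admissible timetable for crossing the edges of the cover from left to right when steps
follow arcs forwards at even times and backwards at odd times. -/
structure IsSchedule (W : Word) [NeZero W.length] (T : ℤ → ℤ) (D : ℤ) : Prop where
  lt_succ : ∀ a, T a < T (a + 1)
  succ_le : ∀ a, T (a + 1) ≤ T a + 2
  star : ∀ a, W.get (residue W (a + 1)) = .star → T (a + 1) = T a + 1
  plus : ∀ a, W.get (residue W a) = .plus → Even (T a)
  minus : ∀ a, W.get (residue W a) = .minus → ¬ Even (T a)
  period : ∀ a, T (a + W.length) = T a + D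

/-- The time needed, after an edge crossed at time `τ`, to cross an edge with a given letter. -/
def waitingTime : Letter → ℤ → ℤ
  | .star, _ => 1
  | .plus, τ => if Even τ then 2 else 1
  | .minus, τ => if Even τ then 1 else 2

theorem waitingTime_pos (x : Letter) (τ : ℤ) : 0 < waitingTime x τ := by
  cases x <;> simp only [waitingTime] <;> first | (split_ifs <;> norm_num) | norm_num

theorem waitingTime_le (x : Letter) (τ : ℤ) : waitingTime x τ ≤ 2 := by
  cases x <;> simp only [waitingTime] <;> first | (split_ifs <;> norm_num) | norm_num

theorem even_add_waitingTime_plus (τ : ℤ) : Even (τ + waitingTime .plus τ) := by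
  simp only [waitingTime]
  split_ifs with h <;> rw [Int.even_iff] at * <;> omega

theorem not_even_add_waitingTime_minus (τ : ℤ) : ¬ Even (τ + waitingTime .minus τ) := by
  simp only [waitingTime]
  split_ifs with h <;> rw [Int.even_iff] at * <;> omega

/-- Each edge is crossed as early as possible, starting with edge `-1` at time `0`. That edge is
`+`, so time `0` has the right parity, and the return time to it is even, so the timetable extends
periodically. -/
theorem exists_isSchedule (hplus : W.get (residue W (-1)) = .plus) :
    ∃ T D, IsSchedule W T D := by
  have hn : (0 : ℤ) < W.length := Int.natCast_pos.2 (NeZero.pos W.length)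
  let t : ℕ → ℤ := Nat.rec 0 fun i τ => τ + waitingTime (W.get (residue W i)) τ
  have ht : ∀ i : ℕ, t (i + 1) = t i + waitingTime (W.get (residue W i)) (t i) := fun _ => rfl
  have hres : ∀ a b : ℤ, a % W.length = b % W.length → residue W a = residue W b := fun a b h =>
    residue_eq_iff.2 (Int.modEq_iff_dvd.1 h)
  have heven : ∀ i : ℕ, W.get (residue W ((i : ℤ) - 1)) = .plus → Even (t i) := by
    rintro (_ | i) h
    · exact Even.zero
    · rw [Nat.cast_succ, add_sub_cancel_right] at h
      rw [ht, h]
      exact even_add_waitingTime_plus _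
  have hodd : ∀ i : ℕ, W.get (residue W ((i : ℤ) - 1)) = .minus → ¬ Even (t i) := by
    rintro (_ | i) h
    · exact absurd (hplus.symm.trans h) (by decide)
    · rw [Nat.cast_succ, add_sub_cancel_right] at h
      rw [ht, h]
      exact not_even_add_waitingTime_minus _
  have hD : Even (t W.length) := heven _ (by
    rw [show residue W ((W.length : ℤ) - 1) = residue W (-1) from
      residue_eq_iff.2 ⟨-1, by ring⟩, hplus])
  let r : ℤ → ℕ := fun a => ((a + 1) % W.length).toNat
  have hr : ∀ a, (r a : ℤ) = (a + 1) % W.length := fun a =>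
    Int.toNat_of_nonneg (Int.emod_nonneg _ hn.ne')
  -- `t i` is the crossing time of edge `i - 1`, whence the shift by one.
  let T : ℤ → ℤ := fun a => t (r a) + t W.length * ((a + 1) / W.length)
  have hrres : ∀ a, residue W ((r a : ℤ) - 1) = residue W a := fun a => by
    refine hres _ _ ?_
    rw [hr, Int.emod_sub_emod, add_sub_cancel_right]
  have hrres' : ∀ a, residue W (r a : ℤ) = residue W (a + 1) := fun a => by
    refine hres _ _ ?_
    rw [hr, Int.emod_emod]
  have hsucc : ∀ a, T (a + 1) = t (r a + 1) + t W.length * ((a + 1) / W.length) := by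
    intro a
    have h1 := Int.emod_add_mul_ediv (a + 1) W.length
    have h2 := Int.emod_lt_of_pos (a + 1) hn
    rw [← hr] at h1 h2
    rcases (show r a + 1 < W.length ∨ r a + 1 = W.length by omega) with h | h
    · have hq := (Int.ediv_emod_unique hn (a := a + 1 + 1) (r := r a + 1)
        (q := (a + 1) / W.length)).2 ⟨by omega, by omega, by omega⟩
      have h3 : r (a + 1) = r a + 1 := by have := hr (a + 1); omega
      simp only [T, h3, hq.1]
    · have hq := (Int.ediv_emod_unique hn (a := a + 1 + 1) (r := 0)
        (q := (a + 1) / W.length + 1)).2 ⟨by rw [mul_add]; omega, by omega, by omega⟩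
      have h3 : r (a + 1) = 0 := by have := hr (a + 1); omega
      simp only [T, h3, hq.1, h, show t 0 = 0 from rfl]
      ring
  have hsucc' : ∀ a, T (a + 1) = T a + waitingTime (W.get (residue W (a + 1))) (t (r a)) := by
    intro a
    rw [hsucc, ht, hrres']
    simp only [T]
    ring
  refine ⟨T, t W.length, fun a => ?_, fun a => ?_, fun a h => ?_, fun a h => ?_, fun a h => ?_,
    fun a => ?_⟩
  · have := waitingTime_pos (W.get (residue W (a + 1))) (t (r a))
    rw [hsucc']
    omega
  · have := waitingTime_le (W.get (residue W (a + 1))) (t (r a))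
    rw [hsucc']
    omega
  · rw [hsucc', h]
    rfl
  · exact (heven _ (by rw [hrres, h])).add (hD.mul_right _)
  · have h1 := hodd (r a) (by rw [hrres, h])
    simp only [T]
    rw [Int.even_add]
    simp [h1, hD.mul_right]
  · have h1 : a + W.length + 1 = a + 1 + W.length := by ring
    have h2 : r (a + W.length) = r a := by
      simp only [r, h1, Int.add_emod_right]
    simp only [T, h2, h1, Int.add_ediv_of_dvd_right (dvd_refl _), Int.ediv_self hn.ne']
    ring

namespace IsSchedule

variable {T : ℤ → ℤ} {D : ℤ}

theorem add_le (hT : IsSchedule W T D) (a : ℤ) (m : ℕ) : T a + m ≤ T (a + m) := by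
  induction m with
  | zero => simp
  | succ m ih =>
    have := hT.lt_succ (a + m)
    push_cast
    rw [← add_assoc a]
    omega

theorem cross_right (hT : IsSchedule W T D) (a : ℤ) {c : ℤ} (hc : Even c) :
    Reaches (cover W) Even (T a + c) (T a + c + 1) a (a + 1) := by
  refine Reaches.single (fun h => ?_) (fun h => ?_) <;> rw [Int.even_add] at h
  · refine Or.inr (Or.inl ⟨rfl, ?_⟩)
    cases hl : W.get (residue W a)
    · exact Or.inl rfl
    · exact absurd (h.2 hc) (hT.minus a hl)
    · exact Or.inr rfl
  · refine Or.inr (Or.inr ⟨rfl, ?_⟩)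
    cases hl : W.get (residue W a)
    · exact absurd (iff_of_true (hT.plus a hl) hc) h
    · exact Or.inl rfl
    · exact Or.inr rfl

/-- Going left, time is reversed by `τ ↦ c - τ`: an odd `c` exchanges the parities, as an edge
crossed backwards needs the opposite direction. -/
theorem cross_left (hT : IsSchedule W T D) (a : ℤ) {c : ℤ} (hc : ¬ Even c) :
    Reaches (cover W) Even (c - T a) (c - T a + 1) (a + 1) a := by
  refine Reaches.single (fun h => ?_) (fun h => ?_) <;> rw [Int.even_sub] at h
  · refine Or.inr (Or.inr ⟨rfl, ?_⟩)
    cases hl : W.get (residue W a)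
    · exact absurd (h.2 (hT.plus a hl)) hc
    · exact Or.inl rfl
    · exact Or.inr rfl
  · refine Or.inr (Or.inl ⟨rfl, ?_⟩)
    cases hl : W.get (residue W a)
    · exact Or.inl rfl
    · exact absurd (iff_of_false hc (hT.minus a hl)) h
    · exact Or.inr rfl

theorem reaches_right (hT : IsSchedule W T D) {φ a c : ℤ} (hc : Even c) (h : φ ≤ T a + c) (m : ℕ) :
    Reaches (cover W) Even φ (T (a + m) + c + 1) a (a + m + 1) := by
  induction m with
  | zero =>
    simpa using (Reaches.stay cover_refl _ _ _ _).trans h (by omega) (hT.cross_right a hc)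
  | succ m ih =>
    have h1 := hT.lt_succ (a + m)
    have h2 := hT.add_le a m
    push_cast
    rw [← add_assoc]
    exact (ih.trans (by omega) (by omega) (Reaches.stay cover_refl _ _ _ _)).trans
      (χ := T (a + m + 1) + c) (by omega) (by omega) (hT.cross_right _ hc)

theorem reaches_left (hT : IsSchedule W T D) {φ a c : ℤ} (hc : ¬ Even c) (h : φ ≤ c - T (a - 1))
    (m : ℕ) : Reaches (cover W) Even φ (c - T (a - 1 - m) + 1) a (a - 1 - m) := by
  induction m with
  | zero =>
    have := hT.cross_left (a - 1) hc
    rw [sub_add_cancel] at this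
    simpa using (Reaches.stay cover_refl _ _ _ _).trans h (by omega) this
  | succ m ih =>
    have h1 := hT.lt_succ (a - 1 - m - 1)
    have h2 := hT.add_le (a - 1 - m) m
    have h3 := hT.cross_left (a - 1 - m - 1) hc
    rw [sub_add_cancel] at h1 h2 h3
    push_cast
    rw [← sub_sub]
    exact (ih.trans (by omega) (by omega) (Reaches.stay cover_refl _ _ _ _)).trans
      (χ := c - T (a - 1 - m - 1)) (by omega) (by omega) h3

/-- With an alternating pattern, any two vertices of the cycle are joined by a walk whose duration
is about half of the period. -/
theorem reaches_cycle (hT : IsSchedule W T D) (φ : ℤ) (u v : Fin W.length) :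
    Reaches (cycle W) Even φ (φ + D / 2 + 1) u v := by
  have hrefl : ∀ w, (cycle W).Adj w w := fun _ => Or.inl rfl
  rcases eq_or_ne u v with rfl | huv
  · exact Reaches.stay hrefl _ _ _ _
  have huv' : (u : ℕ) ≠ v := fun h => huv (Fin.ext h)
  -- The two ways from `u` to `v` have `m + 1` edges to the right and `l + 1` to the left.
  obtain ⟨m, l, hm, hv⟩ : ∃ m l : ℕ, (m : ℤ) + l + 2 = W.length ∧
      residue W ((u : ℕ) + m + 1 : ℤ) = v := by
    have := u.2
    have := v.2
    rcases lt_or_gt_of_ne huv' with h | h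
    · refine ⟨v - u - 1, W.length - (v - u) - 1, by omega, ?_⟩
      exact (congrArg (residue W) (by omega)).trans (residue_coe v)
    · refine ⟨v + W.length - u - 1, u - v - 1, by omega, ?_⟩
      exact (congrArg (residue W) (by omega)).trans
        ((residue_add_length (v : ℕ)).trans (residue_coe v))
  obtain ⟨a, ha⟩ : ∃ a : ℤ, a = (u : ℕ) := ⟨_, rfl⟩
  have hu : residue W a = u := by rw [ha, residue_coe]
  rw [← ha] at hv
  have hv' : residue W (a - 1 - l) = v := by
    rw [← hv, ← residue_add_length]
    congr 1
    omega
  -- Matching the parity delays the start by at most one.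
  obtain ⟨c, hc, hc1, hc2⟩ : ∃ c, Even c ∧ φ ≤ T a + c ∧ T a + c ≤ φ + 1 := by
    rcases Int.even_or_odd (φ - T a) with h | h
    · exact ⟨φ - T a, h, by omega, by omega⟩
    · exact ⟨φ - T a + 1, h.add_one, by omega, by omega⟩
  obtain ⟨c', hc', hc1', hc2'⟩ :
      ∃ c, ¬ Even c ∧ φ ≤ c - T (a - 1) ∧ c - T (a - 1) ≤ φ + 1 := by
    rcases Int.even_or_odd (φ + T (a - 1)) with h | h
    · exact ⟨φ + T (a - 1) + 1, by rw [Int.not_even_iff_odd]; exact h.add_one, by omega, by omega⟩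
    · exact ⟨φ + T (a - 1), by rwa [Int.not_even_iff_odd], by omega, by omega⟩
  have hright := (hT.reaches_right hc hc1 m).map isHom_residue
  have hleft := (hT.reaches_left hc' hc1' l).map isHom_residue
  rw [hu, hv] at hright
  rw [hu, hv'] at hleft
  have h1 := hT.lt_succ (a + m)
  have h2 := hT.period (a - 1 - l)
  rw [show a - 1 - l + W.length = a + m + 1 by omega] at h2
  have h3 := hT.lt_succ (a - 1)
  rw [sub_add_cancel] at h3
  have h4 := hT.add_le a m
  have h5 := hT.add_le (a - 1 - l) l
  rw [sub_add_cancel] at h5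
  -- The two durations add up to at most `D + 2`: crossings span at most `D - 2` in total, and each
  -- way adds at most one unit for the delay and one for the last crossing.
  rcases le_or_gt (T (a + m) + c + 1) (φ + D / 2 + 1) with h | h
  · exact hright.trans (by omega) h (Reaches.stay hrefl _ _ _ _)
  · exact hleft.trans (by omega) (by omega) (Reaches.stay hrefl _ _ _ _)

/-- No walk for the alternating pattern is ahead of the schedule. -/
theorem lt_of_isWalk (hT : IsSchedule W T D) {φ ψ s : ℤ} {p : ℤ → ℤ} (hφψ : φ ≤ ψ)
    (hp : IsWalk (cover W) Even φ ψ p) (hs : p φ = s)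
    (hφ : ∀ τ, φ ≤ τ → (W.get (residue W s) ≠ .star → (Even τ ↔ Even (T s))) → T s ≤ τ) :
    p ψ ≤ s ∨ T (p ψ - 1) < ψ := by
  induction ψ, hφψ using Int.leInduction with
  | base => exact Or.inl hs.le
  | succ t ht ih =>
    specialize ih fun τ h1 h2 => hp τ h1 (by omega)
    have hstep := hp t ht (by omega)
    have hback : p (t + 1) ≤ p t → p (t + 1) ≤ s ∨ T (p (t + 1) - 1) < t + 1 := by
      intro h
      rcases ih with ih | ih
      · exact Or.inl (h.trans ih)
      · right
        have := hT.add_le (p (t + 1) - 1) (p t - p (t + 1)).toNat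
        rw [Int.toNat_of_nonneg (by omega),
          show p (t + 1) - 1 + (p t - p (t + 1)) = p t - 1 by ring] at this
        omega
    rcases le_or_gt (p (t + 1)) (p t) with h | h
    · exact hback h
    have hpt : p (t + 1) = p t + 1 ∧
        (W.get (residue W (p t)) ≠ .star → (Even t ↔ Even (T (p t)))) := by
      by_cases he : Even t
      · rcases hstep.1 he with h' | ⟨h', hl⟩ | ⟨h', hl⟩
        · omega
        · refine ⟨h', fun hl' => ?_⟩
          exact iff_of_true he (hT.plus _ (hl.resolve_right hl'))
        · omega
      · rcases hstep.2 he with h' | ⟨h', hl⟩ | ⟨h', hl⟩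
        · omega
        · omega
        · refine ⟨h', fun hl' => ?_⟩
          exact iff_of_false he (hT.minus _ (hl.resolve_right hl'))
    rw [hpt.1, add_sub_cancel_right]
    rcases lt_trichotomy (p t) s with h' | h' | h'
    · exact Or.inl (by omega)
    · right
      have := hφ t ht (h' ▸ hpt.2)
      rw [h']
      omega
    · right
      have hlt := ih.resolve_left (by omega)
      have h1 := hT.succ_le (p t - 1)
      have h2 := hT.star (p t - 1)
      rw [sub_add_cancel] at h1 h2
      -- Here `t > T (p t - 1)`. A symmetric edge is scheduled one unit later; any other at most two
      -- units later, and then parity excludes `t = T (p t) - 1`.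
      by_cases hl : W.get (residue W (p t)) = .star
      · have := h2 hl
        omega
      · have h3 := hpt.2 hl
        rw [Int.even_iff, Int.even_iff] at h3
        omega

/-- A starting time for which the edge at `s` cannot be crossed before the schedule. -/
theorem exists_phase (hT : IsSchedule W T D) (s : ℤ) : ∃ φ, φ ≤ T s ∧ φ ≤ T (s - 2) + 3 ∧
    ∀ τ, φ ≤ τ → (W.get (residue W s) ≠ .star → (Even τ ↔ Even (T s))) → T s ≤ τ := by
  have h1 := hT.succ_le (s - 1)
  have h2 := hT.succ_le (s - 2)
  have h3 := hT.star (s - 1)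
  rw [show s - 2 + 1 = s - 1 by ring] at h2
  rw [sub_add_cancel] at h1 h3
  by_cases hl : W.get (residue W s) = .star
  · have := h3 hl
    exact ⟨T s, le_rfl, by omega, fun τ h _ => h⟩
  -- At time `T s - 1` the edge has the wrong parity, so starting one unit early gains nothing.
  · refine ⟨T s - 1, by omega, by omega, fun τ h hτ => ?_⟩
    have h4 := hτ hl
    rw [Int.even_iff, Int.even_iff] at h4
    omega

end IsSchedule

/-- A cycle of length at least six with a symmetric edge and a last letter `+` is Słupecki. -/
theorem isSlupecki_of_six_le (hW : 6 ≤ W.length) (hstar : Letter.star ∈ W)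
    (hplus : W.get (residue W (-1)) = .plus) : IsSlupecki (cycle W) := by
  obtain ⟨T, D, hT⟩ := exists_isSchedule hplus
  refine isSlupecki_of_walks (by omega) hstar fun s => ?_
  obtain ⟨φ, h1, h2, hφ⟩ := hT.exists_phase s
  have h3 := hT.period (s - 2)
  have h4 := hT.add_le s (W.length - 2)
  have h5 := hT.add_le (s - 2) 2
  rw [show s + ((W.length - 2 : ℕ) : ℤ) = s - 2 + W.length by omega, h3] at h4
  push_cast at h5
  rw [sub_add_cancel] at h5
  refine ⟨Even, φ, φ + D / 2 + 1, hT.reaches_cycle φ, fun p hp hps => ?_⟩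
  by_contra! hlt
  have h6 := (hT.lt_of_isWalk (by omega) hp hps hφ).resolve_left (by omega)
  have h7 := hT.add_le (s - 2 + W.length) (p (φ + D / 2 + 1) - 1 - (s - 2 + W.length)).toNat
  rw [Int.toNat_of_nonneg (by omega), add_sub_cancel] at h7
  -- A climb of `n - 1` gives `T (s - 2) + D < φ + D / 2 + 1`. With `φ ≤ T (s - 2) + 3` this forces
  -- `D ≤ 6`; with `φ ≤ T s` and `h4` it forces `D / 2 > n - 3`, so `D ≥ 8` as `n ≥ 6`.
  omega

end Alternating

/-! ### Cycles of length four and five -/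

/-- Two vertices are joined by a walk following the given list of directions, where `true` stands
for a forward arc and `false` for a backward arc. -/
def Joins {V : Type*} (G : Digraph V) : List Bool → V → V → Prop
  | [], x, y => x = y
  | b :: l, x, y => ∃ z, (if b then G.Adj x z else G.Adj z x) ∧ Joins G l z y

instance Joins.decidable {V : Type*} [Fintype V] [DecidableEq V] (G : Digraph V)
    [DecidableRel G.Adj] : ∀ l x y, Decidable (Joins G l x y)
  | [], x, y => inferInstanceAs (Decidable (x = y))
  | b :: l, x, y =>
    have := fun z => Joins.decidable G l z y
    inferInstanceAs (Decidable (∃ z, (if b then G.Adj x z else G.Adj z x) ∧ Joins G l z y))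

instance (W : Word) : DecidableRel (cycle W).Adj := fun u v =>
  inferInstanceAs (Decidable (u = v ∨
    ((v : ℕ) = (u + 1) % W.length ∧ (W.get u = Letter.plus ∨ W.get u = Letter.star)) ∨
    ((u : ℕ) = (v + 1) % W.length ∧ (W.get v = Letter.minus ∨ W.get v = Letter.star))))

theorem Joins.reaches {V : Type*} {G : Digraph V} {d : ℤ → Prop} :
    ∀ {l : List Bool} {φ : ℤ} {x y : V}, (∀ (i : ℕ) (h : i < l.length), d (φ + i) ↔ l[i] = true) →
      Joins G l x y → Reaches G d φ (φ + l.length) x y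
  | [], φ, x, y, _, h => by
    obtain rfl : x = y := h
    exact ⟨fun _ => x, fun t h1 h2 => by simp at h2; omega, rfl, rfl⟩
  | b :: l, φ, x, y, hd, ⟨z, hz, h⟩ => by
    have h0 : d φ ↔ b = true := by
      have := hd 0 (by simp)
      rwa [Nat.cast_zero, add_zero, List.getElem_cons_zero] at this
    have h1 : Reaches G d φ (φ + 1) x z := by
      refine Reaches.single (fun h => ?_) (fun h => ?_) <;> rw [h0] at h <;> simpa [h] using hz
    have h2 : Reaches G d (φ + 1) (φ + 1 + l.length) z y := by
      refine h.reaches fun i hi => ?_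
      have := hd (i + 1) (by simpa using hi)
      rw [List.getElem_cons_succ] at this
      rw [← this]
      push_cast
      rw [add_assoc, add_comm 1]
    rw [List.length_cons, Nat.cast_succ, add_comm (l.length : ℤ), ← add_assoc]
    exact h1.trans (by omega) (by omega) h2

/-- A cycle of length `n` with a symmetric edge is Słupecki if any two vertices are joined by a walk
following one common list of at most `n - 2` directions. -/
theorem isSlupecki_of_joins {W : Word} (hW : 4 ≤ W.length) (hstar : Letter.star ∈ W)
    (l : List Bool) (hl : l.length + 1 < W.length) (h : ∀ u v, Joins (cycle W) l u v) :
    IsSlupecki (cycle W) := by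
  have : NeZero W.length := ⟨by omega⟩
  refine isSlupecki_of_walks hW hstar fun s => ⟨fun t => l[t.toNat]? = some true, 0, 0 + l.length,
    fun u v => (h u v).reaches fun i hi => by simp [hi], fun p hp hps => ?_⟩
  have hle : ∀ m : ℕ, m ≤ l.length → p m ≤ s + m := by
    intro m
    induction m with
    | zero => simp [hps]
    | succ m ih =>
      intro hm
      have hstep := hp m (by omega) (by omega)
      have h1 := ih (by omega)
      have h2 : |p (m + 1) - p m| ≤ 1 := by
        by_cases hd : l[(m : ℤ).toNat]? = some true
        -- Each step moves by at most one, so `n - 2` steps cannot climb `n - 1`.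
        · exact abs_sub_le_of_cover (hstep.1 hd)
        · rw [abs_sub_comm]
          exact abs_sub_le_of_cover (hstep.2 hd)
      rw [abs_le] at h2
      push_cast
      omega
  have := hle l.length le_rfl
  rw [zero_add]
  omega

/-- The self-dual words of length three or four with at least two symmetric letters. -/
theorem short_word_cases {w : Word} (h3 : 3 ≤ w.length) (h5 : w.length < 5)
    (hdual : w = Word.dual w) (hstar : 2 ≤ w.count .star) :
    w ∈ ([[.star, .star, .star], [.plus, .star, .star, .minus], [.minus, .star, .star, .plus],
      [.star, .plus, .minus, .star], [.star, .minus, .plus, .star],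
      [.star, .star, .star, .star]] : List Word) := by
  match w with
  | [x, y, z] =>
    revert hdual hstar
    cases x <;> cases y <;> cases z <;> decide
  | [x, y, z, t] =>
    revert hdual hstar
    cases x <;> cases y <;> cases z <;> cases t <;> decide

/-- For each of the six words an explicit pattern of `n - 2` directions joins all pairs of vertices.
-/
theorem isSlupecki_of_short {w : Word} (h3 : 3 ≤ w.length) (h5 : w.length < 5)
    (hdual : w = Word.dual w) (hstar : 2 ≤ w.count .star) :
    IsSlupecki (cycle (w ++ [.plus])) := by
  have hw := short_word_cases h3 h5 hdual hstar
  simp only [List.mem_cons, List.not_mem_nil, or_false] at hw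
  rcases hw with rfl | rfl | rfl | rfl | rfl | rfl
  · exact isSlupecki_of_joins (by decide) (by decide) [true, false] (by decide) (by decide +kernel)
  · exact isSlupecki_of_joins (by decide) (by decide) [true, true, false] (by decide)
      (by decide +kernel)
  · exact isSlupecki_of_joins (by decide) (by decide) [false, true, true] (by decide)
      (by decide +kernel)
  · exact isSlupecki_of_joins (by decide) (by decide) [true, false, true] (by decide)
      (by decide +kernel)
  · exact isSlupecki_of_joins (by decide) (by decide) [true, false, true] (by decide)
      (by decide +kernel)
  · exact isSlupecki_of_joins (by decide) (by decide) [true, true, false] (by decide)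
      (by decide +kernel)

end Slupecki

/-! ### Conclusion -/

theorem theorem5p4 (k : ℕ) (hk : 3 ≤ k) (P : Digraph (Fin (k + 1)))
    (hP : Slupecki.IsPath P) (hdual : Slupecki.IsSelfDual P)
    (hsym : 2 ≤ Slupecki.numSymmetricEdges P) :
    Slupecki.IsSlupecki
      (Slupecki.cycle (Slupecki.pathWord P ++ [Slupecki.Letter.plus])) := by
  have hlen : (Slupecki.pathWord P).length = k := by simp [Slupecki.pathWord]
  unfold Slupecki.IsSelfDual at hdual
  unfold Slupecki.numSymmetricEdges at hsym
  generalize Slupecki.pathWord P = w at *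
  subst hlen
  rcases lt_or_ge w.length 5 with h5 | h5
  · exact Slupecki.isSlupecki_of_short hk h5 hdual hsym
  · have hW : (w ++ [Slupecki.Letter.plus]).length = w.length + 1 := by simp
    have : NeZero (w ++ [Slupecki.Letter.plus]).length := ⟨by omega⟩
    refine Slupecki.isSlupecki_of_six_le (by omega)
      (List.mem_append_left _ (List.count_pos_iff.1 (by omega))) ?_
    have hlast : Slupecki.residue (w ++ [Slupecki.Letter.plus]) (-1) = ⟨w.length, by omega⟩ := by
      rw [← Slupecki.residue_coe ⟨w.length, by omega⟩, Slupecki.residue_eq_iff]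
      exact ⟨1, by simp⟩
    rw [hlast]
    simp
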